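/- Let $d \ge 0$ and let $C_1 \subseteq C_2$ be closed convex cones in $\mathbb{R}^d$ (containing $0$). Write $\Pi_C$ for the Euclidean projection onto a closed convex cone $C$ and $C^* = \{v : \langle v,u\rangle \le 0 \text{ for all } u \in C\}$ for its polar cone, and suppose that the pair is non-oblique, i.e. $\Pi_{C_1}(x) = \Pi_{C_1}(\Pi_{C_2}(x))$ for all $x \in \mathbb{R}^d$. Let $K = C_2 \cap C_1^*$, let $g \sim N(0, I_d)$, and define $$\delta^2_{\mathrm{OPT}}(C_1,C_2) = \min\left\{ \mathbb{E}\|\Pi_K g\|_2,\ \left(\frac{\mathbb{E}\|\Pi_K g\|_2}{\sup_{\eta \in K,\ \|\eta\|_2 = 1} \langle \eta, \mathbb{E}\,\Pi_K g\rangle}\right)^2 \right\},$$ where the supremum in the denominator equals $\|\mathbb{E}\,\Pi_K g\|_2$ whenever $K \ne \{0\}$, where the second term is $+\infty$ if the denominator is $0$, and where $\delta^2_{\mathrm{OPT}}(C_1,C_2) = 0$ if $K = \{0\}$. For $\sigma > 0$ and $\theta \in \mathbb{R}^d$ let $\mathbb{E}_\theta$ denote expectation under the model $y = \theta + \sigma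 g$. For $\epsilon > 0$ and a test, i.e. a measurable function $\psi : \mathbb{R}^d \to \{0,1\}$, define the uniform error $$\mathcal{E}(\psi; C_1, C_2, \epsilon) = \sup_{\theta \in C_1} \mathbb{E}_\theta[\psi(y)] + \sup_{\theta \in C_2,\ \operatorname{dist}(\theta, C_1) > \epsilon} \mathbb{E}_\theta[1 - \psi(y)].$$ Theorem. There are positive numbers $\{\kappa_\rho : \rho \in (0,1/2]\}$, depending on nothing but $\rho$, such that for all $d$, all nested non-oblique pairs $C_1 \subseteq C_2$ of closed convex cones in $\mathbb{R}^d$, all $\sigma > 0$, all $\epsilon > 0$ and all $\rho \in (0, 1/2]$, $$\inf_{\psi} \mathcal{E}(\psi; C_1, C_2, \epsilon) \ge \rho \qquad \text{whenever } \epsilon^2 \le \kappa_\rho\, \sigma^2\, \delta^2_{\mathrm{OPT}}(C_1,C_2);$$ in particular one can take $\kappa_\rho = 1/14$ for all $\rho \in (0, 1/2]$. -/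

import Mathlib

open MeasureTheory ProbabilityTheory
open scoped RealInnerProductSpace

noncomputable section

namespace ConeTest

/-- Euclidean space of dimension `d`. -/
abbrev E (d : ℕ) : Type := EuclideanSpace ℝ (Fin d)

/-- A closed convex cone in `ℝ^d`: a closed set that contains `0` and is stable under sums and
under multiplication by non-negative scalars. -/
abbrev Cone (d : ℕ) : Type := ProperCone ℝ (E d)

variable {d : ℕ}

/-- Every point has a nearest point in a closed convex cone. -/
theorem exists_nearest (C : Cone d) (v : E d) :
    ∃ u ∈ C, ∀ w ∈ C, ‖v - u‖ ≤ ‖v - w‖ := by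
  obtain ⟨u, hu, h⟩ :=
    exists_norm_eq_iInf_of_complete_convex C.nonempty C.isClosed.isComplete C.convex v
  refine ⟨u, hu, fun w hw => ?_⟩
  rw [h]
  exact ciInf_le ⟨0, by rintro _ ⟨x, rfl⟩; exact norm_nonneg _⟩ (⟨w, hw⟩ : (C : Set (E d)))

/-- The Euclidean projection `Π_C(v) = argmin_{u ∈ C} ‖v - u‖`. -/
def proj (C : Cone d) (v : E d) : E d := Classical.choose (exists_nearest C v)

theorem proj_mem (C : Cone d) (v : E d) : proj C v ∈ C :=
  (Classical.choose_spec (exists_nearest C v)).1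

theorem norm_sub_proj_le (C : Cone d) (v : E d) {w : E d} (hw : w ∈ C) :
    ‖v - proj C v‖ ≤ ‖v - w‖ :=
  (Classical.choose_spec (exists_nearest C v)).2 w hw

/-- Variational characterization of a nearest point. -/
theorem inner_le_zero_of_nearest (C : Cone d) {v u : E d} (hu : u ∈ C)
    (h : ∀ w ∈ C, ‖v - u‖ ≤ ‖v - w‖) {w : E d} (hw : w ∈ C) : ⟪v - u, w - u⟫ ≤ 0 := by
  refine (norm_eq_iInf_iff_real_inner_le_zero C.convex hu).1 ?_ w hw
  have : Nonempty (C : Set (E d)) := ⟨⟨u, hu⟩⟩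
  refine le_antisymm (le_ciInf fun w => h w w.2) ?_
  exact ciInf_le ⟨0, by rintro _ ⟨x, rfl⟩; exact norm_nonneg _⟩ (⟨u, hu⟩ : (C : Set (E d)))

/-- The nearest point is unique, so `proj` does not depend on a choice. -/
theorem eq_proj_of_nearest (C : Cone d) {v u : E d} (hu : u ∈ C)
    (h : ∀ w ∈ C, ‖v - u‖ ≤ ‖v - w‖) : u = proj C v := by
  have h1 := inner_le_zero_of_nearest C hu h (proj_mem C v)
  have h2 := inner_le_zero_of_nearest C (proj_mem C v)
    (fun w hw => norm_sub_proj_le C v hw) hu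
  have h3 : ⟪u - proj C v, u - proj C v⟫ = ⟪v - u, proj C v - u⟫ + ⟪v - proj C v, u - proj C v⟫ := by
    simp only [inner_sub_left, inner_sub_right]; ring
  have h4 : ⟪u - proj C v, u - proj C v⟫ ≤ 0 := by linarith
  rw [real_inner_self_eq_norm_sq] at h4
  exact sub_eq_zero.1 (norm_eq_zero.1 (pow_eq_zero_iff two_ne_zero |>.1 (le_antisymm h4 (sq_nonneg _))))

/-- The projection is 1-Lipschitz (so the Gaussian expectations below are genuine integrals). -/
theorem lipschitz_proj (C : Cone d) : LipschitzWith 1 (proj C) := by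
  refine LipschitzWith.of_dist_le_mul fun x y => ?_
  rw [NNReal.coe_one, one_mul, dist_eq_norm, dist_eq_norm]
  have h1 := inner_le_zero_of_nearest C (proj_mem C x)
    (fun w hw => norm_sub_proj_le C x hw) (proj_mem C y)
  have h2 := inner_le_zero_of_nearest C (proj_mem C y)
    (fun w hw => norm_sub_proj_le C y hw) (proj_mem C x)
  have h3 : ⟪proj C x - proj C y, proj C x - proj C y⟫ = ⟪x - y, proj C x - proj C y⟫
      + ⟪x - proj C x, proj C y - proj C x⟫ + ⟪y - proj C y, proj C x - proj C y⟫ := by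
    simp only [inner_sub_left, inner_sub_right]; ring
  have h4 := real_inner_le_norm (x - y) (proj C x - proj C y)
  rw [real_inner_self_eq_norm_sq] at h3
  by_contra hlt
  have hlt := not_le.1 hlt
  nlinarith [norm_nonneg (x - y)]

/-- `E Π_C g` is the expectation of an integrable random vector. -/
theorem integrable_proj (C : Cone d) : Integrable (proj C) (stdGaussian (E d)) := by
  have h0 : proj C 0 = 0 := by
    refine (eq_proj_of_nearest C (zero_mem C) fun w _ => ?_).symm
    simp
  refine (IsGaussian.integrable_id (μ := stdGaussian (E d))).mono
    (lipschitz_proj C).continuous.aestronglyMeasurable (ae_of_all _ fun x => ?_)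
  have := (lipschitz_proj C).dist_le_mul x 0
  simpa [h0] using this

/-- The polar cone `C* = {v | ⟨v, u⟩ ≤ 0 for all u ∈ C}`. -/
def polar (C : Cone d) : Cone d := ProperCone.innerDual (-(C : Set (E d)))

theorem mem_polar {C : Cone d} {v : E d} : v ∈ polar C ↔ ∀ u ∈ C, ⟪v, u⟫ ≤ 0 := by
  rw [polar, ProperCone.mem_innerDual]
  constructor
  · intro h u hu
    have := h (x := -u) (by simpa using hu)
    rw [inner_neg_left, real_inner_comm] at this
    linarith
  · intro h x hx
    have := h (-x) (by simpa using hx)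
    rw [inner_neg_right, real_inner_comm] at this
    linarith

/-- Non-obliqueness of a pair of cones: `Π_{C₁}(x) = Π_{C₁}(Π_{C₂}(x))` for all `x`. -/
def NonOblique (C₁ C₂ : Cone d) : Prop := ∀ x : E d, proj C₁ x = proj C₁ (proj C₂ x)

/-- The intersection cone `K = C₂ ∩ C₁*`. -/
def interCone (C₁ C₂ : Cone d) : Cone d := C₂ ⊓ polar C₁

/-- `E ‖Π_K g‖₂` for a standard Gaussian vector `g`. -/
def meanNormProj (K : Cone d) : ℝ := ∫ g, ‖proj K g‖ ∂(stdGaussian (E d))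

/-- `E Π_K g` for a standard Gaussian vector `g`. -/
def meanProj (K : Cone d) : E d := ∫ g, proj K g ∂(stdGaussian (E d))

/-- `sup_{η ∈ K, ‖η‖₂ = 1} ⟨η, E Π_K g⟩` (it is set to `0` if `K = {0}`). -/
def supInner (K : Cone d) : ℝ :=
  ⨆ η : ((K : Set (E d)) ∩ Metric.sphere 0 1 : Set (E d)), ⟪(η : E d), meanProj K⟫

open scoped Classical in
/-- `δ²_OPT(C₁, C₂) = min {E‖Π_K g‖, (E‖Π_K g‖ / sup_{η ∈ K ∩ S} ⟨η, E Π_K g⟩)²}`, where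
`K = C₂ ∩ C₁*`. The second term is `+∞` if its denominator vanishes; the minimum is then the
first term. -/
def deltaSqOPT (C₁ C₂ : Cone d) : ℝ :=
  if supInner (interCone C₁ C₂) = 0 then meanNormProj (interCone C₁ C₂)
  else min (meanNormProj (interCone C₁ C₂))
    ((meanNormProj (interCone C₁ C₂) / supInner (interCone C₁ C₂)) ^ 2)

/-- The `ε`-fattening of a cone: the points at distance at most `ε` from it. -/
def fattening (C : Cone d) (ε : ℝ) : Set (E d) := {θ | Metric.infDist θ (C : Set (E d)) ≤ ε}

/-- A test: a measurable function `ℝ^d → {0, 1}`. -/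
def IsTest (ψ : E d → ℝ) : Prop := Measurable ψ ∧ ∀ y, ψ y = 0 ∨ ψ y = 1

/-- `E_θ[f(y)]` under the model `y = θ + σ g` with `g` standard Gaussian. -/
def expect (σ : ℝ) (θ : E d) (f : E d → ℝ) : ℝ := ∫ g, f (θ + σ • g) ∂(stdGaussian (E d))

/-- The uniform error of `ψ` for testing `θ ∈ C₁` against `θ ∈ C₂ \ B₂(C₁; ε)`:
worst-case type I error plus worst-case type II error. -/
def uniformError (σ : ℝ) (ψ : E d → ℝ) (C₁ C₂ : Cone d) (ε : ℝ) : ℝ :=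
  (⨆ θ : (C₁ : Set (E d)), expect σ θ ψ) +
    ⨆ θ : ((C₂ : Set (E d)) \ fattening C₁ ε : Set (E d)), expect σ θ (fun y => 1 - ψ y)

/-- The minimax error: the infimum of the uniform error over all tests. -/
def minimaxError (σ : ℝ) (C₁ C₂ : Cone d) (ε : ℝ) : ℝ :=
  ⨅ ψ : {ψ : E d → ℝ // IsTest ψ}, uniformError σ ψ.1 C₁ C₂ ε

end ConeTest

end

/-! Testing is a Bayes problem: the null is represented by `0` and the alternative by a prior `Q` on
vectors `η` with `σ • η` at distance more than `ε` from `C₁`. If `L` is the likelihood ratio of the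
`Q`-mixture of `N(η, I)` against `N(0, I)`, then `E L² = E exp ⟪η, η'⟫` for independent `η, η' ∼ Q`.
Since `φ L ≤ φ + L² / 4` for `φ ∈ {0, 1}`, the bound `E L² ≤ 2` forces type I plus type II error at
least `1/2 ≥ ρ` (`half_le_minimaxError`).

Write `r = ε / σ`, `m = E‖Π_K g‖`, `v = E Π_K g`. If `r² < 0.69`, a point mass in `K` suffices,
because `exp 0.69 ≤ 2`. Otherwise `m ≥ 14 r²` is large, so the 1-Lipschitz function `‖Π_K g‖`
concentrates around `m`. The prior is then the law of `c Π_K g`, with `c` of order `r / m`,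
conditioned on `‖Π_K g‖` lying between `3m/5` and `7m/5`. Points of `K` lie in `C₂`, and `0` is
their nearest point in `C₁`, so these are genuine alternatives. Given `g'`, the map `g ↦ ⟪Π_K g',
Π_K g⟫` is Lipschitz with constant at most `7m/5`. Two uses of sub-Gaussian concentration therefore
bound `log E exp ⟪η, η'⟫`, up to the cost of conditioning, by `c²‖v‖²` plus terms of order `c⁴(‖v‖²
+ m²)`. The two terms of the minimum defining `δ²_OPT` make `c² m` and `c²‖v‖²` at most `25/126`.

Concentration is proved by the Maurey–Pisier rotation argument. It gives `π²/8` in place of the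
sharp `1/2`, which the constant `1/14` can absorb. -/

/-! ### Density, Cameron–Martin formula and exponential moments of the standard Gaussian measure. -/

section Gaussian

open Filter Topology

variable {V : Type*} [NormedAddCommGroup V] [InnerProductSpace ℝ V] [FiniteDimensional ℝ V]
  [MeasurableSpace V] [BorelSpace V]

variable (V) in
/-- The Lebesgue density of the standard Gaussian measure. -/
noncomputable def stdGaussianPDF (x : V) : ℝ :=
  (2 * Real.pi) ^ (-(Module.finrank ℝ V / 2 : ℝ)) * Real.exp (-(1 / 2) * ‖x‖ ^ 2)

omit [FiniteDimensional ℝ V] [MeasurableSpace V] [BorelSpace V] in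
lemma stdGaussianPDF_nonneg (x : V) : 0 ≤ stdGaussianPDF V x := by
  unfold stdGaussianPDF; positivity

omit [FiniteDimensional ℝ V] in
lemma measurable_stdGaussianPDF : Measurable (stdGaussianPDF V) := by
  unfold stdGaussianPDF; fun_prop

lemma integrable_stdGaussianPDF : Integrable (stdGaussianPDF V) := by
  refine Integrable.const_mul ?_ _
  have h := (GaussianFourier.integrable_cexp_neg_mul_sq_norm_add (V := V) (b := 1 / 2)
    (by norm_num) 0 0).norm
  refine h.congr (ae_of_all _ fun x => ?_)
  simp [Complex.norm_exp, ← Complex.ofReal_pow]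

/-- Both sides are finite measures with the same characteristic function, by the Gaussian Fourier
integral. -/
theorem stdGaussian_eq_withDensity :
    stdGaussian V = volume.withDensity (fun x : V => ENNReal.ofReal (stdGaussianPDF V x)) := by
  have hm : Measurable fun x : V => ENNReal.ofReal (stdGaussianPDF V x) :=
    measurable_stdGaussianPDF.ennreal_ofReal
  have : IsFiniteMeasure
      (volume.withDensity (fun x : V => ENNReal.ofReal (stdGaussianPDF V x))) :=
    isFiniteMeasure_withDensity_ofReal integrable_stdGaussianPDF.2
  refine Measure.ext_of_charFun ?_
  ext t
  rw [charFun_stdGaussian, charFun_apply, integral_withDensity_eq_integral_toReal_smul hm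
    (ae_of_all _ fun x => ENNReal.ofReal_lt_top)]
  have h := GaussianFourier.integral_cexp_neg_mul_sq_norm_add (V := V) (b := 1 / 2)
    (by norm_num) Complex.I t
  have hpi : (0 : ℝ) < 2 * Real.pi := by positivity
  have h2 : ∀ x : V, (ENNReal.ofReal (stdGaussianPDF V x)).toReal •
      Complex.exp (⟪x, t⟫ * Complex.I) =
      (((2 * Real.pi) ^ (-(Module.finrank ℝ V / 2 : ℝ)) : ℝ) : ℂ) *
        Complex.exp (-(1 / 2) * ‖x‖ ^ 2 + Complex.I * ⟪t, x⟫) := by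
    intro x
    rw [ENNReal.toReal_ofReal (stdGaussianPDF_nonneg x), stdGaussianPDF, Complex.real_smul,
      Complex.exp_add, real_inner_comm]
    push_cast
    ring_nf
  simp_rw [h2]
  rw [integral_const_mul, h, ← mul_assoc]
  have h3 : (Real.pi : ℂ) / (1 / 2) = ((2 * Real.pi : ℝ) : ℂ) := by push_cast; ring
  have h4 : ((Module.finrank ℝ V : ℂ) / 2) = ((Module.finrank ℝ V / 2 : ℝ) : ℂ) := by
    push_cast; ring
  rw [h3, h4, ← Complex.ofReal_cpow hpi.le, ← Complex.ofReal_mul, ← Real.rpow_add hpi]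
  simp only [neg_add_cancel, Real.rpow_zero, Complex.ofReal_one, one_mul, Complex.I_sq]
  congr 1
  ring

lemma stdGaussian_absolutelyContinuous : stdGaussian V ≪ volume := by
  rw [stdGaussian_eq_withDensity]
  exact withDensity_absolutelyContinuous _ _

/-- The Cameron–Martin formula for the standard Gaussian measure. -/
theorem lintegral_add_stdGaussian {f : V → ENNReal} (hf : Measurable f) (θ : V) :
    ∫⁻ x, f (θ + x) ∂(stdGaussian V) =
      ∫⁻ x, ENNReal.ofReal (Real.exp (⟪θ, x⟫ - ‖θ‖ ^ 2 / 2)) * f x ∂(stdGaussian V) := by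
  have hm : Measurable fun x : V => ENNReal.ofReal (stdGaussianPDF V x) :=
    measurable_stdGaussianPDF.ennreal_ofReal
  rw [stdGaussian_eq_withDensity, lintegral_withDensity_eq_lintegral_mul _ hm (by fun_prop),
    lintegral_withDensity_eq_lintegral_mul _ hm (by fun_prop),
    ← lintegral_add_left_eq_self _ (-θ)]
  refine lintegral_congr fun x => ?_
  simp only [Pi.mul_apply, add_neg_cancel_left]
  rw [← mul_assoc, ← ENNReal.ofReal_mul (stdGaussianPDF_nonneg x)]
  congr 2
  rw [stdGaussianPDF, stdGaussianPDF, mul_assoc, ← Real.exp_add, neg_add_eq_sub,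
    norm_sub_sq_real, real_inner_comm]
  congr 2
  ring

lemma lintegral_exp_inner_stdGaussian (θ : V) :
    ∫⁻ x, ENNReal.ofReal (Real.exp ⟪θ, x⟫) ∂(stdGaussian V) =
      ENNReal.ofReal (Real.exp (‖θ‖ ^ 2 / 2)) := by
  have h := lintegral_add_stdGaussian (V := V) (f := fun _ => 1) measurable_const θ
  simp only [lintegral_const, measure_univ, mul_one] at h
  have h2 : ∀ x : V, ENNReal.ofReal (Real.exp ⟪θ, x⟫) = ENNReal.ofReal (Real.exp (‖θ‖ ^ 2 / 2)) *
      ENNReal.ofReal (Real.exp (⟪θ, x⟫ - ‖θ‖ ^ 2 / 2)) := by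
    intro x
    rw [← ENNReal.ofReal_mul (Real.exp_pos _).le, ← Real.exp_add]
    ring_nf
  simp_rw [h2]
  rw [lintegral_const_mul _ (by fun_prop), ← h, mul_one]

/-- Fernique's theorem makes `exp (C‖x‖²)` integrable for some `C > 0`; completing the square
compares `c‖x‖` with `C‖x‖²`. -/
lemma integrable_exp_norm_stdGaussian (c : ℝ) :
    Integrable (fun x : V => Real.exp (c * ‖x‖)) (stdGaussian V) := by
  obtain ⟨C, hC, hi⟩ := IsGaussian.exists_integrable_exp_sq (stdGaussian V)
  refine (hi.const_mul (Real.exp (c ^ 2 / (4 * C)))).mono' (by fun_prop) (ae_of_all _ fun x => ?_)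
  rw [Real.norm_of_nonneg (Real.exp_pos _).le, ← Real.exp_add, Real.exp_le_exp]
  have h : c ^ 2 / (4 * C) + C * ‖x‖ ^ 2 - c * ‖x‖ = C * (‖x‖ - c / (2 * C)) ^ 2 := by
    field_simp; ring
  nlinarith [mul_nonneg hC.le (sq_nonneg (‖x‖ - c / (2 * C)))]

lemma lintegral_exp_norm_prod_stdGaussian_ne_top (c : ℝ) :
    ∫⁻ p : V × V, ENNReal.ofReal (Real.exp (c * (‖p.1‖ + ‖p.2‖)))
      ∂((stdGaussian V).prod (stdGaussian V)) ≠ ⊤ := by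
  have h := (integrable_exp_norm_stdGaussian (V := V) c).mul_prod
    (integrable_exp_norm_stdGaussian (V := V) c)
  have h2 := h.lintegral_lt_top.ne
  simpa only [← Real.exp_add, ← mul_add] using h2

lemma LipschitzWith.integrable_exp_stdGaussian {f : V → ℝ} {L : NNReal} (hf : LipschitzWith L f) :
    Integrable (fun x => Real.exp (f x)) (stdGaussian V) := by
  refine ((integrable_exp_norm_stdGaussian (V := V) L).const_mul (Real.exp (f 0))).mono'
    hf.continuous.rexp.aestronglyMeasurable (ae_of_all _ fun x => ?_)
  rw [Real.norm_of_nonneg (Real.exp_pos _).le, ← Real.exp_add, Real.exp_le_exp]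
  have h := hf.dist_le_mul x 0
  rw [Real.dist_eq, dist_zero_right] at h
  linarith [le_abs_self (f x - f 0)]

lemma LipschitzWith.integrable_stdGaussian {f : V → ℝ} {L : NNReal} (hf : LipschitzWith L f) :
    Integrable f (stdGaussian V) := by
  refine (hf.integrable_exp_stdGaussian.add hf.neg.integrable_exp_stdGaussian).mono'
    hf.continuous.aestronglyMeasurable (ae_of_all _ fun x => ?_)
  simp only [Pi.add_apply, Pi.neg_apply]
  rw [Real.norm_eq_abs, abs_le]
  constructor <;> linarith [Real.add_one_le_exp (f x), Real.add_one_le_exp (-f x),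
    Real.exp_pos (f x), Real.exp_pos (-f x)]

/-! ### Gaussian concentration for Lipschitz functions by rotation. -/

/-- One step of the rotation path between two independent Gaussian vectors. -/
noncomputable def rotationIncrement (f : V → ℝ) (n : ℕ) (p : V × V) : ℝ :=
  n * (f (Real.cos ((n : ℝ)⁻¹ * (Real.pi / 2)) • p.1 + Real.sin ((n : ℝ)⁻¹ * (Real.pi / 2)) • p.2)
    - f p.1)

omit [FiniteDimensional ℝ V] [MeasurableSpace V] [BorelSpace V] in
lemma continuous_rotationIncrement {f : V → ℝ} (hf : Continuous f) (n : ℕ) :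
    Continuous (rotationIncrement f n) := by
  unfold rotationIncrement; fun_prop

-- The bound does not depend on `n`, so it supplies the dominating function for the limit `n → ∞`.
omit [FiniteDimensional ℝ V] [MeasurableSpace V] [BorelSpace V] in
lemma rotationIncrement_le {f : V → ℝ} {L : NNReal} (hf : LipschitzWith L f) {n : ℕ} (hn : 0 < n)
    (p : V × V) : rotationIncrement f n p ≤ L * (Real.pi / 2) * (‖p.1‖ + ‖p.2‖) := by
  have hn' : (1 : ℝ) ≤ n := by exact_mod_cast hn
  set h : ℝ := (n : ℝ)⁻¹ * (Real.pi / 2) with hh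
  have hn1 : (n : ℝ)⁻¹ ≤ 1 := inv_le_one_of_one_le₀ hn'
  have h0 : 0 ≤ h := by positivity
  have h2 : h ≤ 2 := by nlinarith [Real.pi_le_four, Real.pi_pos]
  have hnh : n * h = Real.pi / 2 := by rw [hh]; field_simp
  -- Uses `1 - cos h ≤ h² / 2 ≤ h`, valid for `0 ≤ h ≤ 2`.
  have hcos : |Real.cos h - 1| ≤ h := by
    rw [abs_le]
    constructor <;> nlinarith [Real.one_sub_sq_div_two_le_cos (x := h), Real.cos_le_one h]
  have hsin : |Real.sin h| ≤ h := by
    have := Real.abs_sin_le_abs (x := h)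
    rwa [abs_of_nonneg h0] at this
  have hd := hf.dist_le_mul (Real.cos h • p.1 + Real.sin h • p.2) p.1
  have he : Real.cos h • p.1 + Real.sin h • p.2 - p.1 =
      (Real.cos h - 1) • p.1 + Real.sin h • p.2 := by module
  rw [Real.dist_eq, dist_eq_norm, he] at hd
  have hnorm : ‖(Real.cos h - 1) • p.1 + Real.sin h • p.2‖ ≤ h * (‖p.1‖ + ‖p.2‖) := by
    refine (norm_add_le _ _).trans ?_
    rw [norm_smul, norm_smul, Real.norm_eq_abs, Real.norm_eq_abs, mul_add]
    gcongr
  calc rotationIncrement f n p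
      ≤ n * (L * (h * (‖p.1‖ + ‖p.2‖))) := by
        unfold rotationIncrement
        gcongr
        exact (le_abs_self _).trans (hd.trans (by gcongr))
    _ = L * (n * h) * (‖p.1‖ + ‖p.2‖) := by ring
    _ = _ := by rw [hnh]

omit [FiniteDimensional ℝ V] [MeasurableSpace V] [BorelSpace V] in
lemma tendsto_rotationIncrement {f : V → ℝ} {p : V × V} (hf : DifferentiableAt ℝ f p.1) :
    Tendsto (fun n => rotationIncrement f n p) atTop (𝓝 (Real.pi / 2 * fderiv ℝ f p.1 p.2)) := by
  have hc : HasDerivAt (fun t : ℝ => Real.cos t • p.1 + Real.sin t • p.2) p.2 0 := by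
    have := ((Real.hasDerivAt_cos 0).smul_const p.1).fun_add
      ((Real.hasDerivAt_sin 0).smul_const p.2)
    simpa using this
  have hfc : HasDerivAt (fun t : ℝ => f (Real.cos t • p.1 + Real.sin t • p.2))
      (fderiv ℝ f p.1 p.2) 0 := by
    refine HasFDerivAt.comp_hasDerivAt (f := fun t : ℝ => Real.cos t • p.1 + Real.sin t • p.2)
      0 ?_ hc
    simpa using hf.hasFDerivAt
  have h := hfc.hasFDerivAt.lim (Real.pi / 2) (c := fun n : ℕ => (n : ℝ)) (l := atTop)
    (by simpa using tendsto_natCast_atTop_atTop)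
  simpa [rotationIncrement] using h

/-- Averaging over the steps of the rotation path, by convexity of the exponential. -/
lemma lintegral_exp_sub_le_rotationIncrement {f : V → ℝ} (hf : Continuous f) {n : ℕ}
    (hn : 0 < n) :
    ∫⁻ p : V × V, ENNReal.ofReal (Real.exp (f p.2 - f p.1))
        ∂((stdGaussian V).prod (stdGaussian V)) ≤
      ∫⁻ p, ENNReal.ofReal (Real.exp (rotationIncrement f n p))
        ∂((stdGaussian V).prod (stdGaussian V)) := by
  have hn' : (0 : ℝ) < n := by exact_mod_cast hn
  set μ := (stdGaussian V).prod (stdGaussian V)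
  set h : ℝ := (n : ℝ)⁻¹ * (Real.pi / 2) with hh
  set R : ℕ → V × V → V × V := fun k => ContinuousLinearMap.rotation (k * h) with hR
  have hstep : ∀ (k : ℕ) (p : V × V), rotationIncrement f n (R k p) =
      n * (f (R (k + 1) p).1 - f (R k p).1) := by
    intro k p
    have : Real.cos h • (R k p).1 + Real.sin h • (R k p).2 = (R (k + 1) p).1 := by
      simp only [hR, ContinuousLinearMap.rotation_apply]
      push_cast
      rw [add_mul, one_mul, Real.cos_add, Real.sin_add]
      module
    rw [rotationIncrement, ← hh, this]
  -- The steps telescope from angle `0`, whose first coordinate is `p.1`, to angle `π / 2`, whose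
  -- first coordinate is `p.2`.
  have hends : ∀ p : V × V, f p.2 - f p.1 =
      ∑ k ∈ Finset.range n, (n : ℝ)⁻¹ • rotationIncrement f n (R k p) := by
    intro p
    have h1 : ∀ k, (n : ℝ)⁻¹ • rotationIncrement f n (R k p) =
        f (R (k + 1) p).1 - f (R k p).1 := by
      intro k
      rw [hstep, smul_eq_mul, inv_mul_cancel_left₀ hn'.ne']
    simp_rw [h1]
    rw [Finset.sum_range_sub (fun k => f (R k p).1)]
    have hnh : (n : ℝ) * h = Real.pi / 2 := by rw [hh]; field_simp
    simp [hR, ContinuousLinearMap.rotation_apply, hnh]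
  have hmeas : Measurable fun p => ENNReal.ofReal (Real.exp (rotationIncrement f n p)) :=
    (continuous_rotationIncrement hf n).rexp.measurable.ennreal_ofReal
  have hRm : ∀ k, Measurable (R k) := fun k =>
    (ContinuousLinearMap.rotation (E := V) (k * h)).continuous.measurable
  -- The product Gaussian is rotation invariant, so every step has the law of the first.
  have hinv : ∀ k, ∫⁻ p, ENNReal.ofReal (Real.exp (rotationIncrement f n (R k p))) ∂μ =
      ∫⁻ p, ENNReal.ofReal (Real.exp (rotationIncrement f n p)) ∂μ := by
    intro k
    rw [← lintegral_map hmeas (hRm k)]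
    congr 1
    exact IsGaussian.map_rotation_eq_self (by simp) _
  calc ∫⁻ p : V × V, ENNReal.ofReal (Real.exp (f p.2 - f p.1)) ∂μ
      ≤ ∫⁻ p, ∑ k ∈ Finset.range n, ENNReal.ofReal (n : ℝ)⁻¹ *
          ENNReal.ofReal (Real.exp (rotationIncrement f n (R k p))) ∂μ := by
        refine lintegral_mono fun p => ?_
        simp_rw [← ENNReal.ofReal_mul (inv_nonneg.2 hn'.le)]
        rw [← ENNReal.ofReal_sum_of_nonneg (fun k _ => by positivity), hends p]
        refine ENNReal.ofReal_le_ofReal ?_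
        refine convexOn_exp.map_sum_le (fun _ _ => by positivity) ?_ (fun _ _ => Set.mem_univ _)
        simp [hn'.ne']
    _ = ∑ k ∈ Finset.range n, ENNReal.ofReal (n : ℝ)⁻¹ *
          ∫⁻ p, ENNReal.ofReal (Real.exp (rotationIncrement f n p)) ∂μ := by
        have hm : ∀ k, Measurable fun p =>
            ENNReal.ofReal (Real.exp (rotationIncrement f n (R k p))) :=
          fun k => hmeas.comp (hRm k)
        rw [lintegral_finsetSum _ fun k _ => (hm k).const_mul _]
        refine Finset.sum_congr rfl fun k _ => ?_
        rw [lintegral_const_mul _ (hm k), hinv]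
    _ = _ := by
        rw [Finset.sum_const, Finset.card_range, nsmul_eq_mul, ← mul_assoc,
          ENNReal.ofReal_inv_of_pos hn', ENNReal.ofReal_natCast,
          ENNReal.mul_inv_cancel (by exact_mod_cast hn.ne') (ENNReal.natCast_ne_top n), one_mul]

/-- Refining the rotation path replaces `f Y - f X` by `(π / 2) f'(X) Y`, with `f'` existing almost
everywhere by Rademacher's theorem. Given `X` this is a centred Gaussian of standard deviation at
most `πL / 2`, and `(πL / 2)² / 2 = π² L² / 8`. -/
theorem LipschitzWith.lintegral_exp_sub_le {f : V → ℝ} {L : NNReal} (hf : LipschitzWith L f) :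
    ∫⁻ p : V × V, ENNReal.ofReal (Real.exp (f p.2 - f p.1))
        ∂((stdGaussian V).prod (stdGaussian V)) ≤
      ENNReal.ofReal (Real.exp (Real.pi ^ 2 / 8 * L ^ 2)) := by
  set μ := (stdGaussian V).prod (stdGaussian V)
  have hdiff : ∀ᵐ p : V × V ∂μ, DifferentiableAt ℝ f p.1 :=
    Measure.quasiMeasurePreserving_fst.ae
      (stdGaussian_absolutelyContinuous.ae_le hf.ae_differentiableAt)
  -- The index is shifted to `n + 1` because the averaging inequality needs at least one step.
  have hlim : Tendsto
      (fun n : ℕ => ∫⁻ p, ENNReal.ofReal (Real.exp (rotationIncrement f (n + 1) p)) ∂μ) atTop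
      (𝓝 (∫⁻ p, ENNReal.ofReal (Real.exp (Real.pi / 2 * fderiv ℝ f p.1 p.2)) ∂μ)) := by
    refine tendsto_lintegral_of_dominated_convergence
      (fun p => ENNReal.ofReal (Real.exp (L * (Real.pi / 2) * (‖p.1‖ + ‖p.2‖)))) (fun n =>
        (continuous_rotationIncrement hf.continuous _).rexp.measurable.ennreal_ofReal)
      (fun n => ae_of_all _ fun p => ?_) (lintegral_exp_norm_prod_stdGaussian_ne_top _) ?_
    · exact ENNReal.ofReal_le_ofReal (Real.exp_le_exp.2 (rotationIncrement_le hf n.succ_pos p))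
    · filter_upwards [hdiff] with p hp
      exact ENNReal.tendsto_ofReal ((Real.continuous_exp.tendsto _).comp
        ((tendsto_add_atTop_iff_nat 1).2 (tendsto_rotationIncrement hp)))
  refine (ge_of_tendsto' hlim fun n =>
    lintegral_exp_sub_le_rotationIncrement hf.continuous n.succ_pos).trans ?_
  have hmeas : Measurable fun p : V × V =>
      ENNReal.ofReal (Real.exp (Real.pi / 2 * fderiv ℝ f p.1 p.2)) := by
    have h1 : Measurable fun p : V × V => (fderiv ℝ f p.1, p.2) :=
      ((measurable_fderiv ℝ f).comp measurable_fst).prodMk measurable_snd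
    have h2 : Continuous fun q : (V →L[ℝ] ℝ) × V => q.1 q.2 := by fun_prop
    exact ((h2.measurable.comp h1).const_mul _).exp.ennreal_ofReal
  rw [lintegral_prod _ hmeas.aemeasurable]
  refine (lintegral_mono (g := fun _ => ENNReal.ofReal (Real.exp (Real.pi ^ 2 / 8 * L ^ 2)))
    fun x => ?_).trans (by simp)
  set u : V := (Real.pi / 2) • (InnerProductSpace.toDual ℝ V).symm (fderiv ℝ f x) with hu
  have h1 : ∀ y, Real.pi / 2 * fderiv ℝ f x y = ⟪u, y⟫ := by
    intro y
    rw [hu, real_inner_smul_left, InnerProductSpace.toDual_symm_apply]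
  simp_rw [h1]
  rw [lintegral_exp_inner_stdGaussian]
  refine ENNReal.ofReal_le_ofReal (Real.exp_le_exp.2 ?_)
  have h2 : ‖u‖ ≤ Real.pi / 2 * L := by
    rw [hu, norm_smul, LinearIsometryEquiv.norm_map, Real.norm_of_nonneg (by positivity)]
    gcongr
    exact norm_fderiv_le_of_lipschitz ℝ hf
  nlinarith [norm_nonneg u, mul_nonneg Real.pi_pos.le L.2]

/-- Gaussian concentration: a Lipschitz function of a standard Gaussian vector is
sub-Gaussian. -/
theorem LipschitzWith.lintegral_exp_sub_integral_le {f : V → ℝ} {L : NNReal}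
    (hf : LipschitzWith L f) :
    ∫⁻ x, ENNReal.ofReal (Real.exp (f x - ∫ y, f y ∂(stdGaussian V))) ∂(stdGaussian V) ≤
      ENNReal.ofReal (Real.exp (Real.pi ^ 2 / 8 * L ^ 2)) := by
  refine le_trans ?_ hf.lintegral_exp_sub_le
  have hm : Measurable fun p : V × V => ENNReal.ofReal (Real.exp (f p.2 - f p.1)) := by
    have := hf.continuous
    have h2 : Continuous fun p : V × V => Real.exp (f p.2 - f p.1) := by fun_prop
    exact h2.measurable.ennreal_ofReal
  rw [lintegral_prod_symm _ hm.aemeasurable]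
  -- Jensen's inequality in the independent copy: `exp (f x - E f) ≤ E exp (f x - f Y)`.
  refine lintegral_mono fun x => ?_
  have hi : Integrable (fun y => Real.exp (f x - f y)) (stdGaussian V) := by
    have := hf.neg.integrable_exp_stdGaussian.const_mul (Real.exp (f x))
    simpa only [← Real.exp_add, sub_eq_add_neg, Pi.neg_apply] using this
  rw [← ofReal_integral_eq_lintegral_ofReal hi (ae_of_all _ fun _ => (Real.exp_pos _).le)]
  refine ENNReal.ofReal_le_ofReal ?_
  have hfi := hf.integrable_stdGaussian
  have h := convexOn_exp.map_integral_le (μ := stdGaussian V) (f := fun y => f x - f y)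
    Real.continuous_exp.continuousOn isClosed_univ (by simp)
    ((integrable_const _).sub hfi) hi
  rwa [integral_sub (integrable_const _) hfi, integral_const, probReal_univ, one_smul] at h

theorem LipschitzWith.lintegral_exp_mul_sub_integral_le {f : V → ℝ} {L : NNReal}
    (hf : LipschitzWith L f) (t : ℝ) :
    ∫⁻ x, ENNReal.ofReal (Real.exp (t * (f x - ∫ y, f y ∂(stdGaussian V)))) ∂(stdGaussian V) ≤
      ENNReal.ofReal (Real.exp (Real.pi ^ 2 / 8 * (t * L) ^ 2)) := by
  have h := (lipschitzWith_smul t).comp hf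
  have h2 := h.lintegral_exp_sub_integral_le
  simpa [integral_const_mul, mul_sub, mul_pow] using h2

/-- A Lipschitz function of a standard Gaussian vector is close to its mean. -/
theorem LipschitzWith.measure_le_abs_sub_integral_le {f : V → ℝ} (hf : LipschitzWith 1 f)
    (t r : ℝ) (ht : 0 ≤ t) :
    stdGaussian V {x | r ≤ |f x - ∫ y, f y ∂(stdGaussian V)|} ≤
      ENNReal.ofReal (2 * Real.exp (Real.pi ^ 2 / 8 * t ^ 2 - t * r)) := by
  set m := ∫ y, f y ∂(stdGaussian V) with hm
  -- Summing the two exponentials treats both tails in one application of Markov's inequality.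
  set F : V → ENNReal := fun x => ENNReal.ofReal (Real.exp (t * (f x - m))) +
    ENNReal.ofReal (Real.exp (-t * (f x - m))) with hF
  have hfm : Measurable f := hf.continuous.measurable
  have hint : ∫⁻ x, F x ∂(stdGaussian V) ≤
      ENNReal.ofReal (2 * Real.exp (Real.pi ^ 2 / 8 * t ^ 2)) := by
    rw [hF, lintegral_add_left (by fun_prop), two_mul,
      ENNReal.ofReal_add (Real.exp_pos _).le (Real.exp_pos _).le]
    have h1 := hf.lintegral_exp_mul_sub_integral_le t
    have h2 := hf.lintegral_exp_mul_sub_integral_le (-t)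
    rw [NNReal.coe_one, mul_one] at h1 h2
    rw [neg_sq] at h2
    exact add_le_add h1 h2
  have hsub : {x | r ≤ |f x - m|} ⊆ {x | ENNReal.ofReal (Real.exp (t * r)) ≤ F x} := by
    intro x hx
    have hx' : r ≤ |f x - m| := hx
    rcases le_abs.1 hx' with h | h
    · exact le_add_right (ENNReal.ofReal_le_ofReal (Real.exp_le_exp.2 (by gcongr)))
    · refine le_add_left (ENNReal.ofReal_le_ofReal (Real.exp_le_exp.2 ?_))
      nlinarith
  have hpos : 0 < Real.exp (t * r) := Real.exp_pos _
  calc stdGaussian V {x | r ≤ |f x - m|}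
      ≤ stdGaussian V {x | ENNReal.ofReal (Real.exp (t * r)) ≤ F x} := measure_mono hsub
    _ ≤ (∫⁻ x, F x ∂(stdGaussian V)) / ENNReal.ofReal (Real.exp (t * r)) :=
        meas_ge_le_lintegral_div (by fun_prop) (by simpa using hpos) ENNReal.ofReal_ne_top
    _ ≤ ENNReal.ofReal (2 * Real.exp (Real.pi ^ 2 / 8 * t ^ 2)) /
          ENNReal.ofReal (Real.exp (t * r)) := by gcongr
    _ = _ := by
        rw [← ENNReal.ofReal_div_of_pos hpos, mul_div_assoc, ← Real.exp_sub]

end Gaussian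

/-! ### Second moment method for Gaussian mixtures. -/

section Bayes

variable {V : Type*} [NormedAddCommGroup V] [InnerProductSpace ℝ V] [FiniteDimensional ℝ V]
  [MeasurableSpace V] [BorelSpace V]

/-- The likelihood ratio of `N(η, I)` with respect to `N(0, I)`. -/
noncomputable def gaussianLikelihoodRatio (η x : V) : ENNReal :=
  ENNReal.ofReal (Real.exp (⟪η, x⟫ - ‖η‖ ^ 2 / 2))

lemma measurable_gaussianLikelihoodRatio :
    Measurable (Function.uncurry (gaussianLikelihoodRatio (V := V))) := by
  unfold gaussianLikelihoodRatio Function.uncurry; fun_prop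

/-- By Cameron–Martin, one factor is absorbed by translating the Gaussian by `η`; what remains is a
Gaussian exponential moment. -/
lemma lintegral_gaussianLikelihoodRatio_mul (η η' : V) :
    ∫⁻ x, gaussianLikelihoodRatio η x * gaussianLikelihoodRatio η' x ∂(stdGaussian V) =
      ENNReal.ofReal (Real.exp ⟪η, η'⟫) := by
  have hm : Measurable (gaussianLikelihoodRatio η') :=
    measurable_gaussianLikelihoodRatio.of_uncurry_left
  have h := lintegral_add_stdGaussian hm η
  rw [show ∫⁻ x, gaussianLikelihoodRatio η x * gaussianLikelihoodRatio η' x ∂(stdGaussian V) =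
    ∫⁻ x, gaussianLikelihoodRatio η' (η + x) ∂(stdGaussian V) from h.symm]
  have h2 : ∀ x, gaussianLikelihoodRatio η' (η + x) =
      ENNReal.ofReal (Real.exp (⟪η, η'⟫ - ‖η'‖ ^ 2 / 2)) * ENNReal.ofReal (Real.exp ⟪η', x⟫) := by
    intro x
    rw [gaussianLikelihoodRatio, ← ENNReal.ofReal_mul (Real.exp_pos _).le, ← Real.exp_add,
      inner_add_right, real_inner_comm η' η]
    ring_nf
  simp_rw [h2]
  rw [lintegral_const_mul _ (by fun_prop), lintegral_exp_inner_stdGaussian,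
    ← ENNReal.ofReal_mul (Real.exp_pos _).le, ← Real.exp_add]
  ring_nf

lemma lintegral_sq_mixture_gaussianLikelihoodRatio (Q : Measure V) [SFinite Q] :
    ∫⁻ x, (∫⁻ η, gaussianLikelihoodRatio η x ∂Q) * (∫⁻ η, gaussianLikelihoodRatio η x ∂Q)
        ∂(stdGaussian V) =
      ∫⁻ η, ∫⁻ η', ENNReal.ofReal (Real.exp ⟪η, η'⟫) ∂Q ∂Q := by
  have hu := measurable_gaussianLikelihoodRatio (V := V)
  have hx : ∀ x : V, Measurable fun η => gaussianLikelihoodRatio η x := fun x =>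
    hu.of_uncurry_right
  have h1 : ∀ x : V,
      (∫⁻ η, gaussianLikelihoodRatio η x ∂Q) * (∫⁻ η, gaussianLikelihoodRatio η x ∂Q) =
      ∫⁻ η, ∫⁻ η', gaussianLikelihoodRatio η x * gaussianLikelihoodRatio η' x ∂Q ∂Q := by
    intro x
    rw [← lintegral_mul_const _ (hx x)]
    exact lintegral_congr fun η => (lintegral_const_mul _ (hx x)).symm
  have h3 : Measurable fun q : (V × V) × V =>
      gaussianLikelihoodRatio q.1.2 q.1.1 * gaussianLikelihoodRatio q.2 q.1.1 :=
    (hu.comp (by fun_prop : Measurable fun q : (V × V) × V => (q.1.2, q.1.1))).mul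
      (hu.comp (by fun_prop : Measurable fun q : (V × V) × V => (q.2, q.1.1)))
  simp_rw [h1]
  rw [lintegral_lintegral_swap h3.lintegral_prod_right'.aemeasurable]
  refine lintegral_congr fun η => ?_
  have h4 : Measurable fun q : V × V =>
      gaussianLikelihoodRatio η q.1 * gaussianLikelihoodRatio q.2 q.1 :=
    (hu.comp (by fun_prop : Measurable fun q : V × V => (η, q.1))).mul
      (hu.comp (by fun_prop : Measurable fun q : V × V => (q.2, q.1)))
  rw [lintegral_lintegral_swap h4.aemeasurable]
  exact lintegral_congr fun η' => lintegral_gaussianLikelihoodRatio_mul η η'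

lemma ENNReal.le_one_add_sq_div_four (a : ENNReal) : a ≤ 1 + a * a / 4 := by
  rcases eq_or_ne a ⊤ with rfl | ha
  · simp [ENNReal.top_div_of_ne_top]
  · lift a to NNReal using ha
    have : a ≤ 1 + a * a / 4 := by
      rw [← NNReal.coe_le_coe]
      push_cast
      nlinarith [sq_nonneg ((a : ℝ) - 2)]
    have h4 : ((4 : NNReal) : ENNReal) = 4 := by norm_num
    rw [← h4]
    exact_mod_cast this

/-- Second moment bound: no test can tell apart `N(0, I)` from a mixture of Gaussians whose
likelihood ratio has small second moment. -/
theorem lintegral_mixture_le (Q : Measure V) [SFinite Q] {φ : V → ENNReal} (hφ : Measurable φ)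
    (hφ01 : ∀ x, φ x = 0 ∨ φ x = 1) :
    ∫⁻ η, ∫⁻ x, φ (η + x) ∂(stdGaussian V) ∂Q ≤
      ∫⁻ x, φ x ∂(stdGaussian V) +
        (∫⁻ η, ∫⁻ η', ENNReal.ofReal (Real.exp ⟪η, η'⟫) ∂Q ∂Q) / 4 := by
  have hu := measurable_gaussianLikelihoodRatio (V := V)
  set L : V → ENNReal := fun x => ∫⁻ η, gaussianLikelihoodRatio η x ∂Q with hL
  have hLm : Measurable L := hu.lintegral_prod_left
  have h1 : ∫⁻ η, ∫⁻ x, φ (η + x) ∂(stdGaussian V) ∂Q = ∫⁻ x, L x * φ x ∂(stdGaussian V) := by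
    have : ∀ η, ∫⁻ x, φ (η + x) ∂(stdGaussian V) =
        ∫⁻ x, gaussianLikelihoodRatio η x * φ x ∂(stdGaussian V) := fun η =>
      lintegral_add_stdGaussian hφ η
    simp_rw [this]
    rw [lintegral_lintegral_swap (hu.mul (hφ.comp measurable_snd)).aemeasurable]
    exact lintegral_congr fun x => lintegral_mul_const _ hu.of_uncurry_right
  rw [h1, ← lintegral_sq_mixture_gaussianLikelihoodRatio]
  calc ∫⁻ x, L x * φ x ∂(stdGaussian V)
      ≤ ∫⁻ x, (φ x + L x * L x / 4) ∂(stdGaussian V) := by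
        refine lintegral_mono fun x => ?_
        rcases hφ01 x with h | h
        · simp [h]
        · simpa [h] using ENNReal.le_one_add_sq_div_four (L x)
    _ = _ := by
        simp_rw [div_eq_mul_inv]
        rw [lintegral_add_left hφ, lintegral_mul_const _ (by fun_prop : Measurable fun x => L x * L x)]

end Bayes

/-! ### From a prior on the alternative to the minimax error. -/

namespace ConeTest

variable {d : ℕ}

lemma IsTest.bounds {ψ : E d → ℝ} (hψ : IsTest ψ) (y : E d) : 0 ≤ ψ y ∧ ψ y ≤ 1 := by
  rcases hψ.2 y with h | h <;> simp [h]

lemma IsTest.one_sub {ψ : E d → ℝ} (hψ : IsTest ψ) : IsTest (fun y => 1 - ψ y) :=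
  ⟨hψ.1.const_sub 1, fun y => by rcases hψ.2 y with h | h <;> simp [h]⟩

lemma IsTest.integrable {ψ : E d → ℝ} (hψ : IsTest ψ) (σ : ℝ) (θ : E d) :
    Integrable (fun g => ψ (θ + σ • g)) (stdGaussian (E d)) := by
  refine Integrable.of_bound (hψ.1.comp (by fun_prop)).aestronglyMeasurable 1
    (ae_of_all _ fun g => ?_)
  have := hψ.bounds (θ + σ • g)
  rw [Real.norm_eq_abs, abs_le]
  exact ⟨by linarith, this.2⟩

lemma IsTest.expect_le_one {ψ : E d → ℝ} (hψ : IsTest ψ) (σ : ℝ) (θ : E d) :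
    expect σ θ ψ ≤ 1 := by
  have := integral_mono (hψ.integrable σ θ) (integrable_const 1) fun g => (hψ.bounds _).2
  simpa [expect] using this

lemma IsTest.expect_one_sub {ψ : E d → ℝ} (hψ : IsTest ψ) (σ : ℝ) (θ : E d) :
    expect σ θ (fun y => 1 - ψ y) = 1 - expect σ θ ψ := by
  rw [expect, expect, integral_sub (integrable_const _) (hψ.integrable σ θ)]
  simp

lemma IsTest.ofReal_expect {ψ : E d → ℝ} (hψ : IsTest ψ) (σ : ℝ) (θ : E d) :
    ENNReal.ofReal (expect σ θ ψ) =
      ∫⁻ g, ENNReal.ofReal (ψ (θ + σ • g)) ∂(stdGaussian (E d)) :=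
  ofReal_integral_eq_lintegral_ofReal (hψ.integrable σ θ) (ae_of_all _ fun _ => (hψ.bounds _).1)

lemma IsTest.expect_le_iSup {ψ : E d → ℝ} (hψ : IsTest ψ) (σ : ℝ) {S : Set (E d)} {θ : E d}
    (hθ : θ ∈ S) : expect σ θ ψ ≤ ⨆ θ : S, expect σ θ ψ :=
  le_ciSup (f := fun θ : S => expect σ θ ψ)
    ⟨1, by rintro _ ⟨x, rfl⟩; exact hψ.expect_le_one σ x⟩ ⟨θ, hθ⟩

/-- Bayesian lower bound on the uniform error, for a prior `Q` on the (rescaled) alternative. -/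
theorem half_le_uniformError {C₁ C₂ : Cone d} {σ ε : ℝ} (Q : Measure (E d))
    [IsProbabilityMeasure Q] (hQ : ∀ᵐ η ∂Q, σ • η ∈ (C₂ : Set (E d)) \ fattening C₁ ε)
    (hQ2 : ∫⁻ η, ∫⁻ η', ENNReal.ofReal (Real.exp ⟪η, η'⟫) ∂Q ∂Q ≤ 2)
    {ψ : E d → ℝ} (hψ : IsTest ψ) : 1 / 2 ≤ uniformError σ ψ C₁ C₂ ε := by
  -- The worst-case type I error is at least that at `θ = 0`, the only null point needed.
  have h0 := hψ.expect_le_iSup σ (zero_mem C₁ : (0 : E d) ∈ (C₁ : Set (E d)))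
  rw [uniformError]
  set S := ⨆ θ : ((C₂ : Set (E d)) \ fattening C₁ ε : Set (E d)), expect σ θ (fun y => 1 - ψ y)
    with hS
  have hφm : Measurable fun x : E d => ENNReal.ofReal (ψ (σ • x)) :=
    (hψ.1.comp (measurable_const_smul σ)).ennreal_ofReal
  have hφ01 : ∀ x : E d, ENNReal.ofReal (ψ (σ • x)) = 0 ∨ ENNReal.ofReal (ψ (σ • x)) = 1 := by
    intro x
    rcases hψ.2 (σ • x) with h | h <;> simp [h]
  have h1 : ENNReal.ofReal (1 - S) ≤
      ∫⁻ η, ∫⁻ x, ENNReal.ofReal (ψ (σ • (η + x))) ∂(stdGaussian (E d)) ∂Q := by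
    calc ENNReal.ofReal (1 - S) = ∫⁻ _, ENNReal.ofReal (1 - S) ∂Q := by simp
      _ ≤ _ := by
        refine lintegral_mono_ae ?_
        filter_upwards [hQ] with η hη
        have h2 := hψ.one_sub.expect_le_iSup σ hη
        rw [hψ.expect_one_sub, ← hS] at h2
        simp_rw [smul_add]
        rw [← hψ.ofReal_expect]
        exact ENNReal.ofReal_le_ofReal (by linarith)
  have h2 := h1.trans (lintegral_mixture_le Q hφm hφ01)
  have h3 : ∫⁻ x, ENNReal.ofReal (ψ (σ • x)) ∂(stdGaussian (E d)) =
      ENNReal.ofReal (expect σ 0 ψ) := by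
    rw [hψ.ofReal_expect]; simp
  have h4 : (∫⁻ η, ∫⁻ η', ENNReal.ofReal (Real.exp ⟪η, η'⟫) ∂Q ∂Q) / 4 ≤
      ENNReal.ofReal (1 / 2) := by
    calc _ ≤ (2 : ENNReal) / 4 := by gcongr
      _ = ENNReal.ofReal 2 / ENNReal.ofReal 4 := by norm_num
      _ = ENNReal.ofReal (1 / 2) := by
        rw [← ENNReal.ofReal_div_of_pos (by norm_num)]; norm_num
  have hT : 0 ≤ expect σ 0 ψ := integral_nonneg fun g => (hψ.bounds _).1
  rw [h3] at h2
  have h5 := h2.trans (add_le_add_right h4 _)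
  rw [← ENNReal.ofReal_add hT (by norm_num), ENNReal.ofReal_le_ofReal_iff (by positivity)] at h5
  linarith

theorem half_le_minimaxError {C₁ C₂ : Cone d} {σ ε : ℝ} (Q : Measure (E d))
    [IsProbabilityMeasure Q] (hQ : ∀ᵐ η ∂Q, σ • η ∈ (C₂ : Set (E d)) \ fattening C₁ ε)
    (hQ2 : ∫⁻ η, ∫⁻ η', ENNReal.ofReal (Real.exp ⟪η, η'⟫) ∂Q ∂Q ≤ 2) :
    1 / 2 ≤ minimaxError σ C₁ C₂ ε := by
  have : Nonempty {ψ : E d → ℝ // IsTest ψ} :=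
    ⟨⟨fun _ => 0, measurable_const, fun _ => Or.inl rfl⟩⟩
  exact le_ciInf fun ψ => half_le_uniformError Q hQ hQ2 ψ.2

end ConeTest

/-! ### Priors supported in `K` and their second moments. -/

namespace ConeTest

variable {d : ℕ}

lemma measurable_proj (C : Cone d) : Measurable (proj C) := (lipschitz_proj C).continuous.measurable

lemma meanProj_mem (K : Cone d) : meanProj K ∈ K :=
  Convex.integral_mem (s := (K : Set (E d))) K.convex K.isClosed (ae_of_all _ (proj_mem K))
    (integrable_proj K)

lemma smul_mem_cone (C : Cone d) {r : ℝ} (hr : 0 ≤ r) {x : E d} (hx : x ∈ C) : r • x ∈ C :=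
  C.toPointedCone.smul_mem hr hx

/-- The mean of a `K`-valued vector lies in the closed convex cone `K`, so its normalization
competes in the supremum. -/
lemma norm_meanProj_le_supInner (K : Cone d) : ‖meanProj K‖ ≤ supInner K := by
  rcases eq_or_ne (meanProj K) 0 with h | h
  · simp [supInner, h]
  · have hn : ‖meanProj K‖ ≠ 0 := norm_ne_zero_iff.2 h
    have hb : BddAbove (Set.range fun η : ((K : Set (E d)) ∩ Metric.sphere 0 1 : Set (E d)) =>
        ⟪(η : E d), meanProj K⟫) := by
      refine ⟨‖meanProj K‖, ?_⟩
      rintro _ ⟨η, rfl⟩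
      have h1 := real_inner_le_norm (η : E d) (meanProj K)
      rwa [mem_sphere_zero_iff_norm.1 η.2.2, one_mul] at h1
    have hmem : ‖meanProj K‖⁻¹ • meanProj K ∈ ((K : Set (E d)) ∩ Metric.sphere 0 1 : Set (E d)) :=
      ⟨smul_mem_cone K (by positivity) (meanProj_mem K), by
        rw [mem_sphere_zero_iff_norm, norm_smul, norm_inv, norm_norm, inv_mul_cancel₀ hn]⟩
    have := le_ciSup hb ⟨_, hmem⟩
    refine le_trans (le_of_eq ?_) this
    simp only
    rw [real_inner_smul_left, real_inner_self_eq_norm_sq]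
    field_simp

lemma deltaSqOPT_le_meanNormProj (C₁ C₂ : Cone d) :
    deltaSqOPT C₁ C₂ ≤ meanNormProj (interCone C₁ C₂) := by
  unfold deltaSqOPT
  split_ifs
  · exact le_rfl
  · exact min_le_left _ _

/-- Division-free form of the second term of the minimum. It also covers a zero denominator, since
then `meanProj` vanishes. -/
lemma deltaSqOPT_mul_le (C₁ C₂ : Cone d) (hδ : 0 ≤ deltaSqOPT C₁ C₂) :
    deltaSqOPT C₁ C₂ * ‖meanProj (interCone C₁ C₂)‖ ^ 2 ≤
      meanNormProj (interCone C₁ C₂) ^ 2 := by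
  have hs := norm_meanProj_le_supInner (interCone C₁ C₂)
  have hv := norm_nonneg (meanProj (interCone C₁ C₂))
  by_cases h0 : supInner (interCone C₁ C₂) = 0
  · have : ‖meanProj (interCone C₁ C₂)‖ = 0 := by linarith
    rw [this]
    nlinarith [sq_nonneg (meanNormProj (interCone C₁ C₂))]
  · have h1 : deltaSqOPT C₁ C₂ ≤
        (meanNormProj (interCone C₁ C₂) / supInner (interCone C₁ C₂)) ^ 2 := by
      rw [deltaSqOPT, if_neg h0]; exact min_le_right _ _
    calc _ ≤ deltaSqOPT C₁ C₂ * supInner (interCone C₁ C₂) ^ 2 := by gcongr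
      _ ≤ (meanNormProj (interCone C₁ C₂) / supInner (interCone C₁ C₂)) ^ 2 *
          supInner (interCone C₁ C₂) ^ 2 := by gcongr
      _ = _ := by field_simp

lemma exists_mem_ne_zero_of_meanNormProj_pos {K : Cone d} (h : 0 < meanNormProj K) :
    ∃ η ∈ K, η ≠ 0 := by
  by_contra! hK
  have : meanNormProj K = 0 := by
    simp [meanNormProj, fun g => hK _ (proj_mem K g)]
  linarith

/-- Points of `C₂ ∩ C₁*` of norm larger than `ε` are alternatives. -/
lemma smul_mem_alternative {C₁ C₂ : Cone d} {σ ε : ℝ} (hσ : 0 < σ) {η : E d}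
    (hη : η ∈ interCone C₁ C₂) (h : ε / σ < ‖η‖) :
    σ • η ∈ (C₂ : Set (E d)) \ fattening C₁ ε := by
  have hη2 : η ∈ C₂ ∧ η ∈ polar C₁ := hη
  refine ⟨smul_mem_cone C₂ hσ.le hη2.1, fun hf => ?_⟩
  -- For `w ∈ C₁`, polarity gives `⟪η, w⟫ ≤ 0`, hence `‖σ • η - w‖ ≥ σ‖η‖`.
  have hd : σ * ‖η‖ ≤ Metric.infDist (σ • η) (C₁ : Set (E d)) := by
    refine (Metric.le_infDist ⟨0, zero_mem C₁⟩).2 fun w hw => ?_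
    have hin := mem_polar.1 hη2.2 w hw
    rw [dist_eq_norm]
    refine (sq_le_sq₀ (by positivity) (norm_nonneg _)).1 ?_
    rw [norm_sub_sq_real, norm_smul, real_inner_smul_left, Real.norm_of_nonneg hσ.le]
    nlinarith [mul_nonneg hσ.le (neg_nonneg.2 hin), sq_nonneg ‖w‖]
  have h3 : Metric.infDist (σ • η) (C₁ : Set (E d)) ≤ ε := hf
  rw [div_lt_iff₀ hσ] at h
  linarith [mul_comm σ ‖η‖]

lemma lintegral_exp_inner_proj_le (K : Cone d) (w : E d) (t : ℝ) :
    ∫⁻ g, ENNReal.ofReal (Real.exp (t * ⟪w, proj K g⟫)) ∂(stdGaussian (E d)) ≤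
      ENNReal.ofReal (Real.exp (t * ⟪w, meanProj K⟫ + Real.pi ^ 2 / 8 * (t * ‖w‖) ^ 2)) := by
  have hf : LipschitzWith ‖w‖₊ fun g => ⟪w, proj K g⟫ := by
    refine LipschitzWith.of_dist_le_mul fun x y => ?_
    rw [Real.dist_eq, ← inner_sub_right]
    refine (abs_real_inner_le_norm _ _).trans ?_
    have := (lipschitz_proj K).dist_le_mul x y
    rw [NNReal.coe_one, one_mul, dist_eq_norm] at this
    rw [coe_nnnorm]
    gcongr
  have h := hf.lintegral_exp_mul_sub_integral_le t
  have hv : ∫ g, ⟪w, proj K g⟫ ∂(stdGaussian (E d)) = ⟪w, meanProj K⟫ :=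
    integral_inner (integrable_proj K) w
  rw [hv] at h
  have hm := measurable_proj K
  have h2 : ∀ g, ENNReal.ofReal (Real.exp (t * ⟪w, proj K g⟫)) =
      ENNReal.ofReal (Real.exp (t * ⟪w, meanProj K⟫)) *
        ENNReal.ofReal (Real.exp (t * (⟪w, proj K g⟫ - ⟪w, meanProj K⟫))) := by
    intro g
    rw [← ENNReal.ofReal_mul (Real.exp_pos _).le, ← Real.exp_add]
    ring_nf
  simp_rw [h2]
  rw [lintegral_const_mul _ (by fun_prop), Real.exp_add, ENNReal.ofReal_mul (Real.exp_pos _).le]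
  gcongr
  simpa using h

/-- The event that the norm of the projection is close to its mean. -/
def typicalSet (K : Cone d) : Set (E d) :=
  {g | |‖proj K g‖ - meanNormProj K| < 2 / 5 * meanNormProj K}

lemma measurableSet_typicalSet (K : Cone d) : MeasurableSet (typicalSet K) := by
  have := measurable_proj K
  exact measurableSet_lt (by fun_prop) measurable_const

lemma pi_sq_div_eight_le : Real.pi ^ 2 / 8 ≤ 1.234 := by
  nlinarith [Real.pi_lt_d4, Real.pi_pos]

lemma le_measure_typicalSet (K : Cone d) (hm : 19 / 2 ≤ meanNormProj K) :
    ENNReal.ofReal (17 / 20) ≤ stdGaussian (E d) (typicalSet K) := by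
  have hf : LipschitzWith 1 fun g => ‖proj K g‖ := by
    simpa [Function.comp_def] using lipschitzWith_one_norm.comp (lipschitz_proj K)
  -- The choice `t = 3/2` nearly minimizes `π² t² / 8 - t r` at `r = 2/5 * 19/2`.
  have h := hf.measure_le_abs_sub_integral_le (3 / 2) (2 / 5 * meanNormProj K) (by norm_num)
  have hc : {x | 2 / 5 * meanNormProj K ≤ |‖proj K x‖ - ∫ y, ‖proj K y‖ ∂(stdGaussian (E d))|} =
      (typicalSet K)ᶜ := by
    ext x
    simp [typicalSet, meanNormProj]
  have hexp : 2 * Real.exp (Real.pi ^ 2 / 8 * (3 / 2) ^ 2 - 3 / 2 * (2 / 5 * meanNormProj K)) ≤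
      3 / 20 := by
    have h1 : Real.pi ^ 2 / 8 * (3 / 2) ^ 2 - 3 / 2 * (2 / 5 * meanNormProj K) ≤ -2.9 := by
      nlinarith [pi_sq_div_eight_le]
    have h2 : (14 : ℝ) ≤ Real.exp 2.9 := by
      have h3 : Real.exp 2.9 = Real.exp 1 * Real.exp 1 * Real.exp 0.9 := by
        rw [← Real.exp_add, ← Real.exp_add]; norm_num
      have h4 := Real.exp_one_gt_d9
      have h5 := Real.add_one_le_exp 0.9
      rw [h3]
      nlinarith [mul_self_nonneg (Real.exp 1 - 2.718), Real.exp_pos 0.9]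
    have h3 : Real.exp (-2.9) ≤ 1 / 14 := by
      rw [Real.exp_neg, ← one_div]
      exact one_div_le_one_div_of_le (by norm_num) h2
    have := Real.exp_le_exp.2 h1
    linarith
  rw [hc] at h
  have h2 := h.trans (ENNReal.ofReal_le_ofReal hexp)
  have h3 := prob_add_prob_compl (μ := stdGaussian (E d)) (measurableSet_typicalSet K)
  have h4 : ENNReal.ofReal (17 / 20) + ENNReal.ofReal (3 / 20) = 1 := by
    rw [← ENNReal.ofReal_add (by norm_num) (by norm_num)]; norm_num
  refine (ENNReal.add_le_add_iff_right (a := ENNReal.ofReal (3 / 20)) ENNReal.ofReal_ne_top).1 ?_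
  rw [h4, ← h3]
  gcongr

/-- The rescaled projection of a Gaussian vector, conditioned on the typical event. -/
noncomputable def projPrior (K : Cone d) (c : ℝ) : Measure (E d) :=
  (cond (stdGaussian (E d)) (typicalSet K)).map (fun g => c • proj K g)

lemma ae_projPrior {K : Cone d} {c : ℝ} {p : E d → Prop} (hp : MeasurableSet {x | p x})
    (h : ∀ g ∈ typicalSet K, p (c • proj K g)) : ∀ᵐ η ∂(projPrior K c), p η := by
  have hm := measurable_proj K
  rw [projPrior, ae_map_iff (by fun_prop) hp]
  exact (ae_cond_mem (measurableSet_typicalSet K)).mono h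

lemma isProbabilityMeasure_projPrior {K : Cone d} (hm : 19 / 2 ≤ meanNormProj K) (c : ℝ) :
    IsProbabilityMeasure (projPrior K c) := by
  have h1 : stdGaussian (E d) (typicalSet K) ≠ 0 := fun h => by
    have := le_measure_typicalSet K hm
    rw [h] at this
    simp at this
    linarith
  have := cond_isProbabilityMeasure h1
  have hm := measurable_proj K
  exact Measure.isProbabilityMeasure_map (by fun_prop)

lemma lintegral_projPrior (K : Cone d) (c : ℝ) {F : E d → ENNReal} (hF : Measurable F) :
    ∫⁻ η, F η ∂(projPrior K c) = (stdGaussian (E d) (typicalSet K))⁻¹ *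
      ∫⁻ g in typicalSet K, F (c • proj K g) ∂(stdGaussian (E d)) := by
  have hm := measurable_proj K
  rw [projPrior, lintegral_map hF (by fun_prop), ProbabilityTheory.cond, lintegral_smul_measure,
    smul_eq_mul]

/-- Concentration is applied first in one copy, where the typical event caps the Lipschitz constant
by `7m/5`, and then in the other, with Lipschitz constant `‖v‖`. Once the cap is used the integrals
extend to the whole space, so conditioning costs only the two inverse probabilities. -/
lemma lintegral_exp_inner_projPrior_le (K : Cone d) (c : ℝ) :
    ∫⁻ η, ∫⁻ η', ENNReal.ofReal (Real.exp ⟪η, η'⟫) ∂(projPrior K c) ∂(projPrior K c) ≤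
      (stdGaussian (E d) (typicalSet K))⁻¹ * ((stdGaussian (E d) (typicalSet K))⁻¹ *
        ENNReal.ofReal (Real.exp (c ^ 2 * ‖meanProj K‖ ^ 2 + Real.pi ^ 2 / 8 * (c ^ 2) ^ 2 *
          (‖meanProj K‖ ^ 2 + (7 / 5 * meanNormProj K) ^ 2)))) := by
  set v := meanProj K
  set m := meanNormProj K
  have hinner : ∀ η : E d, ∫⁻ η', ENNReal.ofReal (Real.exp ⟪η, η'⟫) ∂(projPrior K c) =
      (stdGaussian (E d) (typicalSet K))⁻¹ *
        ∫⁻ g in typicalSet K, ENNReal.ofReal (Real.exp ⟪η, c • proj K g⟫) ∂(stdGaussian (E d)) :=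
    fun η => lintegral_projPrior K c (by fun_prop)
  have hmp := measurable_proj K
  have hmeas : Measurable fun η : E d =>
      ∫⁻ g in typicalSet K, ENNReal.ofReal (Real.exp ⟪η, c • proj K g⟫) ∂(stdGaussian (E d)) := by
    refine Measurable.lintegral_prod_right'
      (f := fun q : E d × E d => ENNReal.ofReal (Real.exp ⟪q.1, c • proj K q.2⟫)) ?_
    have h1 : Measurable fun q : E d × E d => ⟪q.1, c • proj K q.2⟫ :=
      measurable_fst.inner ((hmp.comp measurable_snd).const_smul c)
    exact h1.exp.ennreal_ofReal
  simp_rw [hinner]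
  rw [lintegral_const_mul _ hmeas, lintegral_projPrior K c hmeas]
  gcongr
  calc ∫⁻ g' in typicalSet K, (∫⁻ g in typicalSet K,
        ENNReal.ofReal (Real.exp ⟪c • proj K g', c • proj K g⟫) ∂(stdGaussian (E d)))
          ∂(stdGaussian (E d))
      ≤ ∫⁻ g' in typicalSet K, ENNReal.ofReal (Real.exp (c ^ 2 * ⟪v, proj K g'⟫)) *
          ENNReal.ofReal (Real.exp (Real.pi ^ 2 / 8 * (c ^ 2) ^ 2 * (7 / 5 * m) ^ 2))
          ∂(stdGaussian (E d)) := by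
        refine setLIntegral_mono' (measurableSet_typicalSet K) fun g' hg' => ?_
        refine (setLIntegral_le_lintegral _ _).trans ?_
        have h1 := lintegral_exp_inner_proj_le K (proj K g') (c ^ 2)
        have h2 : ∀ g, ⟪c • proj K g', c • proj K g⟫ = c ^ 2 * ⟪proj K g', proj K g⟫ := by
          intro g
          rw [real_inner_smul_left, real_inner_smul_right]; ring
        simp_rw [h2]
        refine h1.trans ?_
        rw [← ENNReal.ofReal_mul (Real.exp_pos _).le, ← Real.exp_add, real_inner_comm v]
        refine ENNReal.ofReal_le_ofReal (Real.exp_le_exp.2 ?_)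
        have h3 : ‖proj K g'‖ ≤ 7 / 5 * m := by
          have : |‖proj K g'‖ - m| < 2 / 5 * m := hg'
          linarith [(abs_lt.1 this).2]
        rw [mul_pow, ← mul_assoc]
        gcongr
    _ ≤ ∫⁻ g', ENNReal.ofReal (Real.exp (c ^ 2 * ⟪v, proj K g'⟫)) *
          ENNReal.ofReal (Real.exp (Real.pi ^ 2 / 8 * (c ^ 2) ^ 2 * (7 / 5 * m) ^ 2))
          ∂(stdGaussian (E d)) := setLIntegral_le_lintegral _ _
    _ ≤ ENNReal.ofReal (Real.exp (c ^ 2 * ⟪v, v⟫ + Real.pi ^ 2 / 8 * (c ^ 2 * ‖v‖) ^ 2)) *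
          ENNReal.ofReal (Real.exp (Real.pi ^ 2 / 8 * (c ^ 2) ^ 2 * (7 / 5 * m) ^ 2)) := by
        rw [lintegral_mul_const _ (by fun_prop)]
        gcongr
        exact lintegral_exp_inner_proj_le K v (c ^ 2)
    _ = _ := by
        rw [← ENNReal.ofReal_mul (Real.exp_pos _).le, ← Real.exp_add, real_inner_self_eq_norm_sq]
        ring_nf

/-- Used with `x = c²`; `25/126` is `(5/3)² / 14`, from the scale `3m/5` and the constant `1/14`. -/
lemma exponent_bound {x m v : ℝ} (hx : 0 ≤ x) (hm : 19 / 2 ≤ m) (hxm : x * m ≤ 25 / 126)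
    (hxv : x * v ^ 2 ≤ 25 / 126) :
    x * v ^ 2 + Real.pi ^ 2 / 8 * x ^ 2 * (v ^ 2 + (7 / 5 * m) ^ 2) ≤ 3 / 10 := by
  have hx1 : x ≤ 1 / 47 := by nlinarith
  have h1 : x ^ 2 * v ^ 2 ≤ 1 / 47 * (25 / 126) := by
    calc x ^ 2 * v ^ 2 = x * (x * v ^ 2) := by ring
      _ ≤ _ := by gcongr
  have h2 : x ^ 2 * (7 / 5 * m) ^ 2 ≤ (49 / 25) * (25 / 126) ^ 2 := by
    calc x ^ 2 * (7 / 5 * m) ^ 2 = (49 / 25) * (x * m) ^ 2 := by ring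
      _ ≤ _ := by
        have : 0 ≤ x * m := mul_nonneg hx (by linarith)
        gcongr
  have h3 : 0 ≤ x ^ 2 * (v ^ 2 + (7 / 5 * m) ^ 2) := by positivity
  calc _ = x * v ^ 2 + Real.pi ^ 2 / 8 * (x ^ 2 * (v ^ 2 + (7 / 5 * m) ^ 2)) := by ring
    _ ≤ 25 / 126 + 1.234 * (1 / 47 * (25 / 126) + (49 / 25) * (25 / 126) ^ 2) := by
      refine add_le_add hxv (mul_le_mul pi_sq_div_eight_le ?_ h3 (by norm_num))
      linarith [mul_add (x ^ 2) (v ^ 2) ((7 / 5 * m) ^ 2)]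
    _ ≤ 3 / 10 := by norm_num

/-- The numerical budget closes because `(20/17)² * (10/7) < 2`, where `exp (3/10) ≤ 10/7` follows
from `1 - a ≤ exp (-a)`. -/
lemma inv_mul_inv_mul_exp_le_two {p : ENNReal} (hp : ENNReal.ofReal (17 / 20) ≤ p) {a : ℝ}
    (ha : a ≤ 3 / 10) : p⁻¹ * (p⁻¹ * ENNReal.ofReal (Real.exp a)) ≤ 2 := by
  have h1 : p⁻¹ ≤ ENNReal.ofReal (20 / 17) := by
    rw [show (20 / 17 : ℝ) = (17 / 20)⁻¹ by norm_num, ENNReal.ofReal_inv_of_pos (by norm_num)]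
    exact ENNReal.inv_le_inv.2 hp
  have h2 : Real.exp a ≤ 10 / 7 := by
    have h3 : (7 / 10 : ℝ) ≤ Real.exp (-a) := by linarith [Real.add_one_le_exp (-a)]
    have h4 : Real.exp a * Real.exp (-a) = 1 := by rw [← Real.exp_add]; simp
    nlinarith [Real.exp_pos a]
  calc p⁻¹ * (p⁻¹ * ENNReal.ofReal (Real.exp a))
      ≤ ENNReal.ofReal (20 / 17) * (ENNReal.ofReal (20 / 17) * ENNReal.ofReal (10 / 7)) := by
        gcongr
    _ = ENNReal.ofReal (20 / 17 * (20 / 17 * (10 / 7))) := by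
        rw [ENNReal.ofReal_mul (by norm_num), ENNReal.ofReal_mul (by norm_num)]
    _ ≤ ENNReal.ofReal 2 := ENNReal.ofReal_le_ofReal (by norm_num)
    _ = 2 := by norm_num

/-- The minimax lower bound for small radii, from a point alternative. -/
theorem half_le_minimaxError_of_small {C₁ C₂ : Cone d} {σ ε : ℝ} (hσ : 0 < σ)
    (hK : ∃ η ∈ interCone C₁ C₂, η ≠ 0) (hsmall : (ε / σ) ^ 2 < 0.69) :
    1 / 2 ≤ minimaxError σ C₁ C₂ ε := by
  obtain ⟨η₀, hη₀, hne⟩ := hK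
  have hn : ‖η₀‖ ≠ 0 := norm_ne_zero_iff.2 hne
  -- The norm `√0.69` exceeds `ε / σ` strictly, as the alternative requires, while `0.69 < log 2`
  -- keeps the second moment at most `2`.
  set η : E d := (√0.69 * ‖η₀‖⁻¹) • η₀ with hη
  have hηn : ‖η‖ = √0.69 := by
    rw [hη, norm_smul, Real.norm_of_nonneg (by positivity), mul_assoc, inv_mul_cancel₀ hn, mul_one]
  have hmem : σ • η ∈ (C₂ : Set (E d)) \ fattening C₁ ε := by
    refine smul_mem_alternative hσ (smul_mem_cone _ (by positivity) hη₀) ?_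
    rw [hηn]
    exact Real.lt_sqrt_of_sq_lt hsmall
  refine half_le_minimaxError (Measure.dirac η) ?_ ?_
  · rw [ae_dirac_eq]
    exact hmem
  · rw [lintegral_dirac, lintegral_dirac, real_inner_self_eq_norm_sq, hηn,
      Real.sq_sqrt (by norm_num)]
    have h1 : Real.exp 0.69 ≤ 2 := by
      rw [← Real.le_log_iff_exp_le (by norm_num)]
      linarith [Real.log_two_gt_d9]
    calc ENNReal.ofReal (Real.exp 0.69) ≤ ENNReal.ofReal 2 := ENNReal.ofReal_le_ofReal h1
      _ = 2 := by norm_num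

/-- The minimax lower bound for large radii, from a mixture of projected Gaussian vectors. -/
theorem half_le_minimaxError_of_large {C₁ C₂ : Cone d} {σ ε : ℝ} (hσ : 0 < σ) (hε : 0 < ε)
    (hm : 19 / 2 ≤ meanNormProj (interCone C₁ C₂))
    (h1 : 14 * (ε / σ) ^ 2 ≤ meanNormProj (interCone C₁ C₂))
    (h2 : 14 * (ε / σ) ^ 2 * ‖meanProj (interCone C₁ C₂)‖ ^ 2 ≤
      meanNormProj (interCone C₁ C₂) ^ 2) :
    1 / 2 ≤ minimaxError σ C₁ C₂ ε := by
  set K := interCone C₁ C₂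
  set m := meanNormProj K
  have hm0 : 0 < m := by linarith
  have hr : 0 < ε / σ := div_pos hε hσ
  -- The scale at which the lower edge `3m/5` of the typical range is sent to `ε / σ`.
  set c : ℝ := (ε / σ) / (3 / 5 * m) with hc
  have hc0 : 0 < c := by positivity
  have hc2 : c ^ 2 = 25 / 9 * (ε / σ) ^ 2 / m ^ 2 := by
    rw [hc]; field_simp; norm_num
  have := isProbabilityMeasure_projPrior hm c
  refine half_le_minimaxError (projPrior K c) ?_ ?_
  · have hset : MeasurableSet {η : E d | σ • η ∈ (C₂ : Set (E d)) \ fattening C₁ ε} := by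
      refine measurable_const_smul σ (C₂.isClosed.measurableSet.diff ?_)
      exact (isClosed_le (Metric.continuous_infDist_pt _) continuous_const).measurableSet
    refine ae_projPrior (p := fun η => σ • η ∈ (C₂ : Set (E d)) \ fattening C₁ ε) hset
      fun g hg => ?_
    refine smul_mem_alternative hσ (smul_mem_cone K hc0.le (proj_mem K g)) ?_
    have h3 : |‖proj K g‖ - m| < 2 / 5 * m := hg
    have h4 : 3 / 5 * m < ‖proj K g‖ := by linarith [(abs_lt.1 h3).1]
    rw [norm_smul, Real.norm_of_nonneg hc0.le]
    calc ε / σ = c * (3 / 5 * m) := by rw [hc]; field_simp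
      _ < c * ‖proj K g‖ := by gcongr
  · refine (lintegral_exp_inner_projPrior_le K c).trans
      (inv_mul_inv_mul_exp_le_two (le_measure_typicalSet K hm) ?_)
    refine exponent_bound (sq_nonneg c) hm ?_ ?_
    · rw [hc2, div_mul_eq_mul_div, div_le_iff₀ (by positivity)]
      nlinarith
    · rw [hc2, div_mul_eq_mul_div, div_le_iff₀ (by positivity)]
      linarith

end ConeTest

theorem theorem2 (ρ : ℝ) (hρ : ρ ∈ Set.Ioc (0 : ℝ) (1 / 2)) (d : ℕ)
    (C₁ C₂ : ConeTest.Cone d) (hnested : C₁ ≤ C₂) (hno : ConeTest.NonOblique C₁ C₂)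
    (σ : ℝ) (hσ : 0 < σ) (ε : ℝ) (hε : 0 < ε)
    (h : ε ^ 2 ≤ (1 / 14 : ℝ) * σ ^ 2 * ConeTest.deltaSqOPT C₁ C₂) :
    ρ ≤ ConeTest.minimaxError σ C₁ C₂ ε := by
  refine hρ.2.trans ?_
  have hr : 14 * (ε / σ) ^ 2 ≤ ConeTest.deltaSqOPT C₁ C₂ := by
    rw [div_pow, mul_div_assoc', div_le_iff₀ (by positivity)]
    linarith
  have hr0 : 0 < (ε / σ) ^ 2 := by positivity
  have hδ : 0 ≤ ConeTest.deltaSqOPT C₁ C₂ := by linarith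
  have hm := hr.trans (ConeTest.deltaSqOPT_le_meanNormProj C₁ C₂)
  -- In the second case `m ≥ 14 * 0.69 = 9.66`, above the threshold `19/2` needed for concentration.
  rcases lt_or_ge ((ε / σ) ^ 2) 0.69 with hs | hs
  · exact ConeTest.half_le_minimaxError_of_small hσ
      (ConeTest.exists_mem_ne_zero_of_meanNormProj_pos (by linarith)) hs
  · refine ConeTest.half_le_minimaxError_of_large hσ hε (by linarith) hm ?_
    exact (mul_le_mul_of_nonneg_right hr (sq_nonneg _)).trans (ConeTest.deltaSqOPT_mul_le C₁ C₂ hδ)
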